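/- Let $W\colon \{0,1,2,\dots\}\to\{0,1\}$ be a binary word. For a positive integer $n$ let $F_n(W):=\{(W(i),W(i+1),\dots,W(i+n-1)) : i\ge 0\}$ be its set of factors of length $n$, and suppose that $W$ is Sturmian, i.e. $|F_n(W)|=n+1$ for every $n\ge 1$. Then for every positive integer $n$, \[ \sum_{\vec w\in F_n(W)} h(\vec w)\equiv n \pmod 2, \] where $h(\vec w)$ is the number of components of $\vec w$ that are equal to $1$. -/

import Mathlib

/-- The set of factors of length `n` of the binary word `W`, that is, the set of all vectors
`(W i, W (i+1), ..., W (i+n-1))` with `i ≥ 0`. -/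
def wordFactors (W : ℕ → Fin 2) (n : ℕ) : Set (Fin n → Fin 2) :=
  Set.range fun (i : ℕ) (j : Fin n) => W (i + j)

/-- A binary word is Sturmian if it has exactly `n + 1` factors of length `n` for every
`n ≥ 1`. -/
def IsSturmian (W : ℕ → Fin 2) : Prop :=
  ∀ n : ℕ, 1 ≤ n → (wordFactors W n).ncard = n + 1

/-- The height (Hamming weight) of a binary vector: its number of components equal to `1`. -/
def wordHeight {n : ℕ} (w : Fin n → Fin 2) : ℕ :=
  (Finset.univ.filter fun j => w j = 1).card

/-! Passing from length `n` to `n + 1` adds an odd number to the height sum. Dropping the last (or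
first) letter maps the `n + 2` longer factors onto the `n + 1` shorter ones, so exactly one fibre is
double: that of the right special `r` (or left special `l`). Splitting off first letters, the tails
contribute the old sum plus the height of `l`, and the first letters contribute `1` plus the height
of `r`. Since `0l`, `1l`, `r0`, `r1` are all factors, balance makes the two heights equal, so the
increment is `2h + 1`.

Balance is the hard part: a minimal unbalanced pair is `1w1`, `0w0` with `w` a right special
palindrome, and this would make the word eventually deterministic. -/

theorem exists_unique_double_fibre {α β : Type*} [DecidableEq α] [DecidableEq β]
    (A : Finset α) (B : Finset β) (f : α → β) (hf : A.image f = B) (hc : A.card = B.card + 1) :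
    ∃ r ∈ B, (∃ x ∈ A, ∃ y ∈ A, x ≠ y ∧ f x = r ∧ f y = r) ∧
      (∀ x ∈ A, ∀ y ∈ A, x ≠ y → f x = f y → f x = r) ∧
      ∀ g : β → ℕ, ∑ x ∈ A, g (f x) = ∑ y ∈ B, g y + g r := by
  have hmem : ∀ x ∈ A, f x ∈ B := fun x hx => hf ▸ Finset.mem_image_of_mem f hx
  obtain ⟨x, hx, y, hy, hxy, hfxy⟩ :=
    Finset.exists_ne_map_eq_of_card_lt_of_maps_to (by omega : B.card < A.card) hmem
  -- Deleting one of two colliding points leaves a bijection onto `B`, so this collision is the only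
  -- one.
  have himg : (A.erase x).image f = B := by
    rw [← hf]
    ext b
    simp only [Finset.mem_image, Finset.mem_erase]
    constructor
    · rintro ⟨a, ⟨-, ha⟩, rfl⟩
      exact ⟨a, ha, rfl⟩
    · rintro ⟨a, ha, rfl⟩
      by_cases h : a = x
      · exact ⟨y, ⟨hxy.symm, hy⟩, by rw [h, hfxy]⟩
      · exact ⟨a, ⟨h, ha⟩, rfl⟩
  have hinj : Set.InjOn f (A.erase x : Finset α) := by
    apply Finset.injOn_of_card_image_eq
    rw [himg, Finset.card_erase_of_mem hx]
    omega
  refine ⟨f x, hmem x hx, ⟨x, hx, y, hy, hxy, rfl, hfxy.symm⟩, ?_, ?_⟩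
  · intro a ha b hb hab hfab
    by_cases h1 : a = x
    · rw [h1]
    by_cases h2 : b = x
    · rw [hfab, h2]
    exact absurd (hinj (by simp [h1, ha]) (by simp [h2, hb]) hfab) hab
  · intro g
    rw [← Finset.sum_erase_add _ _ hx, ← himg, Finset.sum_image hinj]

/-! ### Factors and their number -/

/-- The factor of length `n` of `W` starting at position `i`. -/
def factorAt (W : ℕ → Fin 2) (n i : ℕ) : Fin n → Fin 2 := fun j => W (i + j)

theorem factorAt_eq_iff {W : ℕ → Fin 2} {n i j : ℕ} :
    factorAt W n i = factorAt W n j ↔ ∀ k < n, W (i + k) = W (j + k) :=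
  ⟨fun h k hk => congrFun h ⟨k, hk⟩, fun h => funext fun k => h k k.2⟩

/-- The finset of factors of length `n`. -/
noncomputable def factorFinset (W : ℕ → Fin 2) (n : ℕ) : Finset (Fin n → Fin 2) :=
  (wordFactors W n).toFinite.toFinset

theorem mem_factorFinset {W : ℕ → Fin 2} {n : ℕ} {w : Fin n → Fin 2} :
    w ∈ factorFinset W n ↔ ∃ i, factorAt W n i = w := by
  simp only [factorFinset, Set.Finite.mem_toFinset]
  exact Iff.rfl

theorem factorAt_mem (W : ℕ → Fin 2) (n i : ℕ) : factorAt W n i ∈ factorFinset W n :=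
  mem_factorFinset.2 ⟨i, rfl⟩

theorem factorFinset_zero_card (W : ℕ → Fin 2) : (factorFinset W 0).card = 1 := by
  rw [Finset.card_eq_one]
  refine ⟨factorAt W 0 0, ?_⟩
  ext w
  simp only [Finset.mem_singleton]
  exact ⟨fun _ => Subsingleton.elim _ _, fun h => h ▸ factorAt_mem W 0 0⟩

theorem IsSturmian.card {W : ℕ → Fin 2} (hW : IsSturmian W) (n : ℕ) :
    (factorFinset W n).card = n + 1 := by
  rcases Nat.eq_zero_or_pos n with rfl | h
  · exact factorFinset_zero_card W
  · rw [← hW n h, Set.ncard_eq_toFinset_card _ (wordFactors W n).toFinite]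
    rfl

theorem init_factorAt (W : ℕ → Fin 2) (n i : ℕ) :
    Fin.init (factorAt W (n + 1) i) = factorAt W n i := rfl

theorem tail_factorAt (W : ℕ → Fin 2) (n i : ℕ) :
    Fin.tail (factorAt W (n + 1) i) = factorAt W n (i + 1) := by
  funext k
  simp only [Fin.tail, factorAt, Fin.val_succ]
  congr 1
  omega

theorem image_init_factorFinset (W : ℕ → Fin 2) (n : ℕ) :
    (factorFinset W (n + 1)).image Fin.init = factorFinset W n := by
  ext w
  simp only [Finset.mem_image, mem_factorFinset]
  constructor
  · rintro ⟨_, ⟨i, rfl⟩, rfl⟩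
    exact ⟨i, rfl⟩
  · rintro ⟨i, rfl⟩
    exact ⟨_, ⟨i, rfl⟩, rfl⟩

/-! ### Aperiodicity and recurrence -/

/-- A word that eventually obeys a recursion of finite order is not Sturmian. -/
theorem IsSturmian.not_deterministic {W : ℕ → Fin 2} (hW : IsSturmian W) (m N : ℕ)
    (h : ∀ i ≥ N, ∀ j ≥ N, factorAt W m i = factorAt W m j → W (i + m) = W (j + m)) : False := by
  classical
  have hext : ∀ t, ∀ i ≥ N, ∀ j ≥ N, factorAt W m i = factorAt W m j →
      W (i + t) = W (j + t) := by
    intro t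
    induction t with
    | zero =>
      intro i hi j hj hij
      rcases Nat.eq_zero_or_pos m with rfl | hm
      · exact h i hi j hj hij
      · exact factorAt_eq_iff.1 hij 0 hm
    | succ t ih =>
      intro i hi j hj hij
      have hs : factorAt W m (i + 1) = factorAt W m (j + 1) := by
        rw [factorAt_eq_iff] at hij ⊢
        intro k hk
        rw [add_assoc, add_assoc, add_comm 1 k]
        rcases Nat.lt_or_ge (k + 1) m with h1 | h1
        · exact hij _ h1
        · have : k + 1 = m := by omega
          rw [this]
          exact h i hi j hj (factorAt_eq_iff.2 hij)
      have := ih (i + 1) (by omega) (j + 1) (by omega) hs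
      rwa [add_assoc, add_assoc, add_comm 1 t] at this
  -- At most `N` factors start before `N` and at most `m + 1` after, one short of the `K + 1`
  -- required.
  let K := N + (m + 1)
  let g : (Fin m → Fin 2) → (Fin K → Fin 2) := fun v =>
    if hv : ∃ i ≥ N, factorAt W m i = v then factorAt W K hv.choose else factorAt W K 0
  have hsub : factorFinset W K ⊆
      (Finset.range N).image (factorAt W K) ∪ (factorFinset W m).image g := by
    intro w hw
    obtain ⟨i, rfl⟩ := mem_factorFinset.1 hw
    rw [Finset.mem_union]
    rcases Nat.lt_or_ge i N with hi | hi
    · exact Or.inl (Finset.mem_image_of_mem _ (Finset.mem_range.2 hi))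
    · right
      refine Finset.mem_image.2 ⟨factorAt W m i, factorAt_mem W m i, ?_⟩
      have hv : ∃ k ≥ N, factorAt W m k = factorAt W m i := ⟨i, hi, rfl⟩
      simp only [g, dif_pos hv]
      exact factorAt_eq_iff.2 fun t _ =>
        hext t _ hv.choose_spec.1 i hi hv.choose_spec.2
  have h1 := (Finset.card_le_card hsub).trans (Finset.card_union_le _ _)
  have h2 : ((Finset.range N).image (factorAt W K)).card ≤ N := by
    simpa using Finset.card_image_le (s := Finset.range N) (f := factorAt W K)
  have h3 : ((factorFinset W m).image g).card ≤ m + 1 := by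
    rw [← hW.card m]
    exact Finset.card_image_le
  have h4 := hW.card K
  omega

/-- Every factor of a Sturmian word occurs arbitrarily far to the right. -/
theorem IsSturmian.recurrent {W : ℕ → Fin 2} (hW : IsSturmian W) (n i N : ℕ) :
    ∃ j ≥ N, factorAt W n j = factorAt W n i := by
  classical
  by_contra! hcon
  let V : ℕ → Fin 2 := fun k => W (N + k)
  have hV : ∀ m k, factorAt V m k = factorAt W m (N + k) := by
    intro m k
    funext t
    simp [factorAt, V, add_assoc]
  have hlt : (factorFinset V n).card < n + 1 := by
    rw [← hW.card n]
    apply Finset.card_lt_card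
    rw [Finset.ssubset_iff_of_subset]
    · refine ⟨factorAt W n i, factorAt_mem W n i, fun hmem => ?_⟩
      obtain ⟨k, hk⟩ := mem_factorFinset.1 hmem
      exact hcon (N + k) (by omega) (by rw [← hV, hk])
    · intro w hw
      obtain ⟨k, rfl⟩ := mem_factorFinset.1 hw
      rw [hV]
      exact factorAt_mem _ _ _
  -- The shifted word has at most `n` factors of length `n`, so its complexity, starting from `1`,
  -- must stall; there each factor determines its next letter.
  obtain ⟨m, hm⟩ : ∃ m, (factorFinset V (m + 1)).card ≤ (factorFinset V m).card := by
    by_contra! hgrow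
    have : ∀ k, k + 1 ≤ (factorFinset V k).card := by
      intro k
      induction k with
      | zero => rw [factorFinset_zero_card]
      | succ k ih => exact Nat.succ_le_of_lt (lt_of_le_of_lt ih (hgrow k))
    exact absurd (this n) (by omega)
  have hinj : Set.InjOn Fin.init (factorFinset V (m + 1) : Set (Fin (m + 1) → Fin 2)) := by
    apply Finset.injOn_of_card_image_eq
    refine le_antisymm Finset.card_image_le ?_
    rw [image_init_factorFinset]
    exact hm
  refine hW.not_deterministic m N fun a ha b hb hab => ?_
  obtain ⟨a, rfl⟩ := Nat.exists_eq_add_of_le ha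
  obtain ⟨b, rfl⟩ := Nat.exists_eq_add_of_le hb
  rw [← hV, ← hV] at hab
  have := hinj (factorAt_mem V (m + 1) a) (factorAt_mem V (m + 1) b) hab
  have := congrFun this (Fin.last m)
  simpa [factorAt, V, add_assoc] using this

/-- Recurrence is needed because a prefix of `W` has no letter before it at position `0`. -/
theorem IsSturmian.image_tail {W : ℕ → Fin 2} (hW : IsSturmian W) (n : ℕ) :
    (factorFinset W (n + 1)).image Fin.tail = factorFinset W n := by
  ext w
  simp only [Finset.mem_image, mem_factorFinset]
  constructor
  · rintro ⟨_, ⟨i, rfl⟩, rfl⟩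
    exact ⟨i + 1, (tail_factorAt W n i).symm⟩
  · rintro ⟨i, rfl⟩
    obtain ⟨j, hj, hji⟩ := hW.recurrent n i 1
    obtain ⟨j, rfl⟩ := Nat.exists_eq_add_of_le' hj
    exact ⟨_, ⟨j, rfl⟩, by rw [tail_factorAt, hji]⟩

/-! ### Special factors -/

/-- `u` has two occurrences in `W` that are followed by different letters. -/
def IsRightSpecial (W : ℕ → Fin 2) {n : ℕ} (u : Fin n → Fin 2) : Prop :=
  ∃ x y, factorAt W n x = u ∧ factorAt W n y = u ∧ W (x + n) = 0 ∧ W (y + n) = 1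

theorem isRightSpecial_of_ne {W : ℕ → Fin 2} {n x y : ℕ}
    (hxy : factorAt W n x = factorAt W n y) (hne : W (x + n) ≠ W (y + n)) :
    IsRightSpecial W (factorAt W n x) := by
  have : (W (x + n) = 0 ∧ W (y + n) = 1) ∨ (W (y + n) = 0 ∧ W (x + n) = 1) := by
    generalize W (x + n) = a at *
    generalize W (y + n) = b at *
    revert a b
    decide
  rcases this with h | h
  · exact ⟨x, y, rfl, hxy.symm, h.1, h.2⟩
  · exact ⟨y, x, hxy.symm, rfl, h.1, h.2⟩

theorem IsRightSpecial.tail {W : ℕ → Fin 2} {n : ℕ} {u : Fin (n + 1) → Fin 2}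
    (h : IsRightSpecial W u) : IsRightSpecial W (Fin.tail u : Fin n → Fin 2) := by
  obtain ⟨x, y, rfl, hy, hx0, hy1⟩ := h
  refine ⟨x + 1, y + 1, (tail_factorAt W n x).symm, by rw [← tail_factorAt, hy], ?_, ?_⟩
  · rwa [add_assoc, add_comm 1 n]
  · rwa [add_assoc, add_comm 1 n]

theorem IsSturmian.exists_rightSpecial {W : ℕ → Fin 2} (hW : IsSturmian W) (n : ℕ) :
    ∃ r : Fin n → Fin 2, IsRightSpecial W r ∧ (∀ u : Fin n → Fin 2, IsRightSpecial W u → u = r) ∧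
      ∀ g : (Fin n → Fin 2) → ℕ, ∑ w ∈ factorFinset W (n + 1), g (Fin.init w) =
        ∑ u ∈ factorFinset W n, g u + g r := by
  obtain ⟨r, -, ⟨v, hv, w, hw, hvw, hvr, hwr⟩, huniq, hsum⟩ :=
    exists_unique_double_fibre _ _ _ (image_init_factorFinset W n)
      (by rw [hW.card, hW.card])
  refine ⟨r, ?_, ?_, hsum⟩
  · obtain ⟨x, rfl⟩ := mem_factorFinset.1 hv
    obtain ⟨y, rfl⟩ := mem_factorFinset.1 hw
    rw [init_factorAt] at hvr hwr
    rw [← hvr]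
    refine isRightSpecial_of_ne (hvr.trans hwr.symm) fun hlast => hvw ?_
    have h := factorAt_eq_iff.1 (hvr.trans hwr.symm)
    refine factorAt_eq_iff.2 fun k hk => ?_
    rcases Nat.lt_succ_iff_lt_or_eq.1 hk with h1 | h1
    · exact h k h1
    · rw [h1, hlast]
  · rintro u ⟨x, y, rfl, hy, hx0, hy1⟩
    refine huniq (factorAt W (n + 1) x) (factorAt_mem _ _ _) (factorAt W (n + 1) y)
      (factorAt_mem _ _ _) (fun heq => ?_) hy.symm
    have := factorAt_eq_iff.1 heq n (by omega)
    rw [hx0, hy1] at this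
    exact absurd this (by decide)

theorem IsSturmian.exists_leftSpecial {W : ℕ → Fin 2} (hW : IsSturmian W) (n : ℕ) :
    ∃ l : Fin n → Fin 2, (∃ x y, factorAt W n (x + 1) = l ∧ factorAt W n (y + 1) = l ∧
        W x = 0 ∧ W y = 1) ∧
      ∀ g : (Fin n → Fin 2) → ℕ, ∑ w ∈ factorFinset W (n + 1), g (Fin.tail w) =
        ∑ u ∈ factorFinset W n, g u + g l := by
  obtain ⟨l, -, ⟨v, hv, w, hw, hvw, hvl, hwl⟩, -, hsum⟩ :=
    exists_unique_double_fibre _ _ _ (hW.image_tail n) (by rw [hW.card, hW.card])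
  refine ⟨l, ?_, hsum⟩
  obtain ⟨x, rfl⟩ := mem_factorFinset.1 hv
  obtain ⟨y, rfl⟩ := mem_factorFinset.1 hw
  have hne : W x ≠ W y := by
    intro h0
    apply hvw
    rw [← Fin.cons_self_tail (factorAt W (n + 1) x), ← Fin.cons_self_tail (factorAt W (n + 1) y),
      hvl, hwl]
    simp [factorAt, h0]
  rw [tail_factorAt] at hvl hwl
  have : (W x = 0 ∧ W y = 1) ∨ (W y = 0 ∧ W x = 1) := by
    generalize W x = a at *
    generalize W y = b at *
    clear hvw
    revert a b
    decide
  rcases this with h | h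
  · exact ⟨x, y, hvl, hwl, h.1, h.2⟩
  · exact ⟨y, x, hwl, hvl, h.1, h.2⟩

/-! ### Heights and balance -/

/-- The number of ones in the factor of length `n` starting at position `i`. -/
def onesCount (W : ℕ → Fin 2) (i n : ℕ) : ℕ := ∑ k ∈ Finset.range n, (W (i + k) : ℕ)

theorem wordHeight_eq_sum {n : ℕ} (w : Fin n → Fin 2) : wordHeight w = ∑ k, (w k : ℕ) := by
  rw [wordHeight, Finset.card_filter]
  refine Finset.sum_congr rfl fun k _ => ?_
  generalize w k = a
  revert a
  decide

theorem wordHeight_factorAt (W : ℕ → Fin 2) (n i : ℕ) :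
    wordHeight (factorAt W n i) = onesCount W i n := by
  rw [wordHeight_eq_sum, onesCount, Finset.sum_range]
  rfl

theorem wordHeight_succ {n : ℕ} (w : Fin (n + 1) → Fin 2) :
    wordHeight w = (w 0 : ℕ) + wordHeight (Fin.tail w : Fin n → Fin 2) := by
  rw [wordHeight_eq_sum, wordHeight_eq_sum, Fin.sum_univ_succ]
  rfl

theorem onesCount_add (W : ℕ → Fin 2) (i a b : ℕ) :
    onesCount W i (a + b) = onesCount W i a + onesCount W (i + a) b := by
  simp only [onesCount, Finset.sum_range_add, add_assoc]

theorem onesCount_succ (W : ℕ → Fin 2) (i n : ℕ) :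
    onesCount W i (n + 1) = onesCount W i n + W (i + n) :=
  Finset.sum_range_succ _ _

theorem onesCount_succ' (W : ℕ → Fin 2) (i n : ℕ) :
    onesCount W i (n + 1) = W i + onesCount W (i + 1) n := by
  rw [add_comm n 1, onesCount_add]
  simp [onesCount]

/-- If `c w c` occurs at position `a` for a palindrome `w` of length `m` and a letter `c`, then the
right special factor of length `m + 1` is not `d w` with `d ≠ c`. -/
theorem IsSturmian.no_palindromic_obstruction {W : ℕ → Fin 2} (hW : IsSturmian W) (a m : ℕ)
    (hpal : ∀ k < m, W (a + 1 + k) = W (a + 1 + (m - 1 - k)))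
    (hend : W (a + (m + 1)) = W a) (r : Fin (m + 1) → Fin 2) (hr : IsRightSpecial W r)
    (h0 : r 0 ≠ W a) (htail : Fin.tail r = factorAt W m (a + 1)) : False := by
  classical
  obtain ⟨r', -, huniq, -⟩ := hW.exists_rightSpecial (m + 1)
  have hrmem : r ∈ factorFinset W (m + 1) := by
    obtain ⟨x, -, hx, -⟩ := hr
    exact hx ▸ factorAt_mem _ _ _
  have hdet : ∀ x y, factorAt W (m + 1) x = factorAt W (m + 1) y → factorAt W (m + 1) x ≠ r →
      W (x + (m + 1)) = W (y + (m + 1)) := by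
    intro x y hxy hx
    by_contra hne
    exact hx ((huniq _ (isRightSpecial_of_ne hxy hne)).trans (huniq r hr).symm)
  have havoid : ∀ t ≤ m + 1, factorAt W (m + 1) (a + t) ≠ r := by
    intro t ht heq
    have hz : W (a + t) = r 0 := by rw [← heq]; rfl
    have htl : factorAt W m (a + t + 1) = factorAt W m (a + 1) := by
      rw [← tail_factorAt, heq, htail]
    rcases Nat.eq_zero_or_pos t with rfl | hpos
    · exact h0 hz.symm
    rcases Nat.lt_or_ge m t with hmt | hmt
    · have : t = m + 1 := by omega
      subst this
      exact h0 (hz.symm.trans hend)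
    -- An occurrence of `r = dw` at `a + t` would put the final `c` at index `m - t` of `w`; its
    -- mirror index `t - 1` holds the letter at `a + t`, which is `d`.
    · have h1 := factorAt_eq_iff.1 htl (m - t) (by omega)
      have h2 := hpal (m - t) (by omega)
      rw [show a + t + 1 + (m - t) = a + (m + 1) by omega, hend] at h1
      rw [show a + 1 + (m - 1 - (m - t)) = a + t by omega, hz] at h2
      exact h0 (h1.trans h2).symm
  -- Pigeonhole: `m + 2` windows, only `m + 1` factors other than `r`. The repetition then cycles
  -- forever without meeting `r`.
  obtain ⟨i, j, hij, hj, heq⟩ : ∃ i j, i < j ∧ j ≤ m + 1 ∧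
      factorAt W (m + 1) (a + i) = factorAt W (m + 1) (a + j) := by
    obtain ⟨x, hx, y, hy, hxy, he⟩ := Finset.exists_ne_map_eq_of_card_lt_of_maps_to
      (s := Finset.range (m + 2)) (t := (factorFinset W (m + 1)).erase r)
      (f := fun t => factorAt W (m + 1) (a + t))
      (by rw [Finset.card_erase_of_mem hrmem, hW.card, Finset.card_range]; omega)
      (fun t ht => Finset.mem_erase.2
        ⟨havoid t (by have := Finset.mem_range.1 ht; omega), factorAt_mem _ _ _⟩)
    rw [Finset.mem_range] at hx hy
    rcases Nat.lt_or_gt_of_ne hxy with h | h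
    · exact ⟨x, y, h, by omega, he⟩
    · exact ⟨y, x, h, by omega, he.symm⟩
  have hcycle : ∀ t, ∃ s, i ≤ s ∧ s < j ∧
      factorAt W (m + 1) (a + i + t) = factorAt W (m + 1) (a + s) := by
    intro t
    induction t with
    | zero => exact ⟨i, le_rfl, hij, rfl⟩
    | succ t ih =>
      obtain ⟨s, his, hsj, hs⟩ := ih
      have hlast := hdet _ _ hs (hs ▸ havoid s (by omega))
      have hstep : factorAt W (m + 1) (a + i + (t + 1)) = factorAt W (m + 1) (a + (s + 1)) := by
        rw [factorAt_eq_iff] at hs ⊢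
        intro k hk
        rw [show a + i + (t + 1) + k = a + i + t + (k + 1) by omega,
          show a + (s + 1) + k = a + s + (k + 1) by omega]
        rcases Nat.lt_or_ge (k + 1) (m + 1) with h1 | h1
        · exact hs _ h1
        · rwa [show k + 1 = m + 1 by omega]
      rcases Nat.lt_or_ge (s + 1) j with h1 | h1
      · exact ⟨s + 1, by omega, h1, hstep⟩
      · rw [show s + 1 = j by omega, ← heq] at hstep
        exact ⟨i, le_rfl, hij, hstep⟩
  refine hW.not_deterministic (m + 1) (a + i) fun x hx y hy hxy => hdet x y hxy ?_
  obtain ⟨t, rfl⟩ := Nat.exists_eq_add_of_le hx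
  obtain ⟨s, -, hsj, hs⟩ := hcycle t
  rw [hs]
  exact havoid s (by omega)

/-- Sturmian words are balanced. -/
theorem IsSturmian.balanced {W : ℕ → Fin 2} (hW : IsSturmian W) (n : ℕ) :
    ∀ i j, onesCount W i n ≤ onesCount W j n + 1 := by
  induction n using Nat.strong_induction_on with
  | _ n ih =>
  intro i j
  by_contra! hun
  -- By minimality, prefix and suffix each contribute at most `1` to an excess of at least `2`.
  have hmid : ∀ k, 0 < k → k < n → onesCount W i k = onesCount W j k + 1 := by
    intro k hk hkn
    have h1 := ih k hkn i j
    have h2 := ih (n - k) (by omega) (i + k) (j + k)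
    have h3 := onesCount_add W i k (n - k)
    have h4 := onesCount_add W j k (n - k)
    rw [show k + (n - k) = n by omega] at h3 h4
    omega
  have hn : 2 ≤ n := by
    by_contra! h
    have hi := (W i).2
    interval_cases n
    · simp [onesCount] at hun
    · simp [onesCount] at hun
      omega
  obtain ⟨m, rfl⟩ := Nat.exists_eq_add_of_le' hn
  have hval : ∀ p q, (W p : ℕ) = W q → W p = W q := fun p q h => Fin.ext h
  have hlt : ∀ p, (W p : ℕ) < 2 := fun p => (W p).2
  have hfirst : (W i : ℕ) = 1 ∧ (W j : ℕ) = 0 := by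
    have h := hmid 1 (by omega) (by omega)
    simp only [onesCount, Finset.sum_range_one, add_zero] at h
    have := hlt i
    omega
  have hlastletter : (W (i + (m + 1)) : ℕ) = 1 ∧ (W (j + (m + 1)) : ℕ) = 0 := by
    have h := hmid (m + 1) (by omega) (by omega)
    have h1 := onesCount_succ W i (m + 1)
    have h2 := onesCount_succ W j (m + 1)
    rw [show m + 1 + 1 = m + 2 from rfl] at h1 h2
    have := hlt (i + (m + 1))
    omega
  have hmiddle : ∀ k < m, W (i + 1 + k) = W (j + 1 + k) := by
    intro k hk
    have h1 := hmid (k + 1) (by omega) (by omega)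
    have h2 := hmid (k + 1 + 1) (by omega) (by omega)
    rw [onesCount_succ, onesCount_succ W j, ← add_assoc, ← add_assoc, add_right_comm i k 1,
      add_right_comm j k 1] at h2
    exact hval _ _ (by omega)
  have hcount : ∀ b k, b + k ≤ m → onesCount W (i + 1 + b) k = onesCount W (j + 1 + b) k := by
    intro b k hbk
    refine Finset.sum_congr rfl fun t ht => ?_
    rw [add_assoc (i + 1), add_assoc (j + 1), hmiddle (b + t)]
    have := Finset.mem_range.1 ht
    omega
  -- With `p`, `s` the prefix and suffix of `w` of length `k`, balance of `1p` against `s0` and of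
  -- `s1` against `0p` gives equal heights.
  have hsym : ∀ k ≤ m, onesCount W (i + 1) k = onesCount W (i + 1 + (m - k)) k := by
    intro k hk
    have h1 := ih (k + 1) (by omega) i (j + 1 + (m - k))
    have h2 := ih (k + 1) (by omega) (i + 1 + (m - k)) j
    rw [onesCount_succ' W i, onesCount_succ W (j + 1 + (m - k)),
      show j + 1 + (m - k) + k = j + (m + 1) by omega] at h1
    rw [onesCount_succ' W j, onesCount_succ W (i + 1 + (m - k)),
      show i + 1 + (m - k) + k = i + (m + 1) by omega] at h2
    have h3 := hcount (m - k) k (by omega)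
    have h4 := hcount 0 k (by omega)
    rw [add_zero, add_zero] at h4
    omega
  have hpal : ∀ k < m, W (i + 1 + k) = W (i + 1 + (m - 1 - k)) := by
    intro k hk
    have h1 := hsym k (by omega)
    have h2 := hsym (k + 1) (by omega)
    rw [onesCount_succ, onesCount_succ' W (i + 1 + (m - (k + 1))),
      show i + 1 + (m - (k + 1)) + 1 = i + 1 + (m - k) by omega,
      show m - (k + 1) = m - 1 - k by omega] at h2
    exact hval _ _ (by omega)
  have hw : factorAt W m (i + 1) = factorAt W m (j + 1) := factorAt_eq_iff.2 hmiddle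
  have hwspecial : IsRightSpecial W (factorAt W m (i + 1)) := by
    refine isRightSpecial_of_ne hw fun h => ?_
    rw [add_assoc, add_assoc, add_comm 1 m] at h
    rw [h] at hlastletter
    omega
  obtain ⟨r, hr, -⟩ := hW.exists_rightSpecial (m + 1)
  obtain ⟨w, -, hwuniq, -⟩ := hW.exists_rightSpecial m
  have htail : Fin.tail r = factorAt W m (i + 1) :=
    (hwuniq _ hr.tail).trans (hwuniq _ hwspecial).symm
  -- Use whichever of `1w1`, `0w0` starts with the letter that `r` does not start with.
  by_cases h0 : r 0 = W i
  · refine hW.no_palindromic_obstruction j m (fun k hk => ?_)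
      (hval _ _ (by omega)) r hr (fun h => ?_) (htail.trans hw)
    · rw [← hmiddle k hk, ← hmiddle (m - 1 - k) (by omega), hpal k hk]
    · rw [h0] at h
      rw [h] at hfirst
      omega
  · exact hW.no_palindromic_obstruction i m hpal (hval _ _ (by omega)) r hr h0 htail

/-! ### The odd increment -/

/-- Each extension in length repeats only the first letter of the right special factor; these
factors are suffixes of one another, so the repeated letters add up to the height of `r`. -/
theorem IsSturmian.sum_first_letter {W : ℕ → Fin 2} (hW : IsSturmian W) (n : ℕ) :
    ∀ r : Fin n → Fin 2, IsRightSpecial W r →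
      ∑ w ∈ factorFinset W (n + 1), (w 0 : ℕ) = 1 + wordHeight r := by
  induction n with
  | zero =>
    intro r _
    have huniv : factorFinset W 1 = Finset.univ := by
      apply Finset.eq_univ_of_card
      rw [hW.card]
      simp
    rw [huniv, wordHeight_eq_sum, Fin.sum_univ_zero]
    decide
  | succ n ih =>
    intro r hr
    obtain ⟨r', -, huniq, hsum⟩ := hW.exists_rightSpecial (n + 1)
    have h := hsum fun u => (u 0 : ℕ)
    rw [← huniq r hr, ih _ hr.tail] at h
    rw [wordHeight_succ r]
    refine Eq.trans ?_ (h.trans (by ring))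
    rfl

theorem IsSturmian.sum_wordHeight_succ {W : ℕ → Fin 2} (hW : IsSturmian W) (n : ℕ) :
    ∃ h, ∑ w ∈ factorFinset W (n + 1), wordHeight w =
      ∑ w ∈ factorFinset W n, wordHeight w + (2 * h + 1) := by
  obtain ⟨r, hr, -⟩ := hW.exists_rightSpecial n
  obtain ⟨l, ⟨x, y, hx, hy, hx0, hy1⟩, hsum⟩ := hW.exists_leftSpecial n
  have hfirst := hW.sum_first_letter n r hr
  have hlr : wordHeight l = wordHeight r := by
    obtain ⟨x', y', hx', hy', hx0', hy1'⟩ := hr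
    have hl0 : onesCount W x (n + 1) = wordHeight l := by
      rw [onesCount_succ', hx0, ← hx, wordHeight_factorAt]; simp
    have hl1 : onesCount W y (n + 1) = 1 + wordHeight l := by
      rw [onesCount_succ', hy1, ← hy, wordHeight_factorAt]; simp
    have hr0 : onesCount W x' (n + 1) = wordHeight r := by
      rw [onesCount_succ, hx0', ← hx', wordHeight_factorAt]; simp
    have hr1 : onesCount W y' (n + 1) = wordHeight r + 1 := by
      rw [onesCount_succ, hy1', ← hy', wordHeight_factorAt]; simp
    have h1 := hW.balanced (n + 1) y x'
    have h2 := hW.balanced (n + 1) y' x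
    omega
  refine ⟨wordHeight r, ?_⟩
  simp only [wordHeight_succ, Finset.sum_add_distrib]
  rw [hsum, hfirst, hlr]
  ring

theorem theorem1 (W : ℕ → Fin 2) (hW : IsSturmian W) (n : ℕ) (hn : 1 ≤ n) :
    (∑ w ∈ (wordFactors W n).toFinite.toFinset, wordHeight w) ≡ n [MOD 2] := by
  change ∑ w ∈ factorFinset W n, wordHeight w ≡ n [MOD 2]
  clear hn
  induction n with
  | zero => simp [wordHeight_eq_sum, Nat.ModEq]
  | succ n ih =>
    obtain ⟨h, hh⟩ := hW.sum_wordHeight_succ n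
    rw [hh]
    unfold Nat.ModEq at ih ⊢
    omega
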